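/- Index the standard basis $|0\rangle,\dots,|5\rangle$ of $\mathbb{C}^6$ by $\mathbb{Z}_6$, let $\omega=e^{2\pi i/6}$, and let $X,Z$ be the $6\times 6$ matrices with $X|j\rangle=|j+1 \bmod 6\rangle$ and $Z|j\rangle=\omega^{j}|j\rangle$. Let $|\Phi\rangle=\frac{1}{\sqrt6}\sum_{j=0}^{5}|j\rangle\otimes|j\rangle\in\mathbb{C}^6\otimes\mathbb{C}^6$. The generalized Bell states are the $36$ vectors $(I\otimes X^mZ^n)|\Phi\rangle$, $m,n\in\mathbb{Z}_6$, and a 4-GBS set is a set of four distinct generalized Bell states; it is denoted by the set of the corresponding matrices $X^mZ^n$. Two such sets $S,T$ are LU-equivalent if there are unitary $6\times6$ matrices $U_A,U_B$ and a bijection $\sigma:S\to T$ such that for every $\phi\in S$ the vectors $\sigma(\phi)$ and $(U_A\otimes U_B)\phi$ are equal up to a complex factor of modulus $1$. There are $\binom{36}{4}=58905$ 4-GBS sets in $\mathbb{C}^6\otimes\mathbb{C}^6$, and they fall into exactly $31$ LU-equivalence classes. Each 4-GBS set is LU-equivalent to exactly one of the following 4-GBS sets: $\mathcal{C}^{1}=\{I,Z,Z^{2},Z^{3}\}$,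 $\mathcal{C}^{2}=\{I,Z,Z^{2},Z^{4}\}$, $\mathcal{C}^{3}=\{I,Z,Z^{2},X\}$, $\mathcal{C}^{4}=\{I,Z,Z^{2},X^{2}\}$, $\mathcal{C}^{5}=\{I,Z,Z^{2},X^{2}Z\}$, $\mathcal{C}^{6}=\{I,Z,Z^{2},X^{3}\}$, $\mathcal{C}^{7}=\{I,Z,Z^{2},X^{3}Z\}$, $\mathcal{C}^{8}=\{I,Z,Z^{3},Z^{4}\}$, $\mathcal{C}^{9}=\{I,Z,Z^{3},X\}$, $\mathcal{C}^{10}=\{I,Z,Z^{3},X^{2}\}$, $\mathcal{C}^{11}=\{I,Z,Z^{3},X^{2}Z\}$, $\mathcal{C}^{12}=\{I,Z,Z^{3},X^{3}\}$, $\mathcal{C}^{13}=\{I,Z,Z^{3},X^{3}Z\}$, $\mathcal{C}^{14}=\{I,Z,Z^{3},X^{5}\}$, $\mathcal{C}^{15}=\{I,Z,X,XZ\}$, $\mathcal{C}^{16}=\{I,Z,X,XZ^{2}\}$, $\mathcal{C}^{17}=\{I,Z,X,XZ^{3}\}$, $\mathcal{C}^{18}=\{I,Z,X,X^{2}Z^{2}\}$,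 $\mathcal{C}^{19}=\{I,Z,X,X^{3}Z^{5}\}$, $\mathcal{C}^{20}=\{I,Z,X,X^{4}Z^{4}\}$, $\mathcal{C}^{21}=\{I,Z,X^{2},X^{2}Z\}$, $\mathcal{C}^{22}=\{I,Z,X^{2},X^{2}Z^{2}\}$, $\mathcal{C}^{23}=\{I,Z,X^{2},X^{2}Z^{5}\}$, $\mathcal{C}^{24}=\{I,Z,X^{2},X^{3}Z\}$, $\mathcal{C}^{25}=\{I,Z,X^{2},X^{4}\}$, $\mathcal{C}^{26}=\{I,Z,X^{3},X^{3}Z\}$, $\mathcal{C}^{27}=\{I,Z,X^{3},X^{3}Z^{3}\}$, $\mathcal{C}^{28}=\{I,Z,X^{3},X^{3}Z^{5}\}$, $\mathcal{C}^{29}=\{I,Z^{2},Z^{4},X^{2}\}$, $\mathcal{C}^{30}=\{I,Z^{2},X^{2},X^{2}Z^{2}\}$, $\mathcal{C}^{31}=\{I,Z^{3},X^{3},X^{3}Z^{3}\}$. -/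

import Mathlib

open scoped TensorProduct

noncomputable section

namespace GBS

/-- The bipartite system `ℂ^d ⊗ ℂ^d`; the computational basis of `ℂ^d` is indexed by `ℤ/d`. -/
abbrev Bipartite (d : ℕ) : Type := (ZMod d → ℂ) ⊗[ℂ] (ZMod d → ℂ)

/-- The local operation `A ⊗ B` on `ℂ^d ⊗ ℂ^d`. -/
def localOp {d : ℕ} [NeZero d] (A B : Matrix (ZMod d) (ZMod d) ℂ) :
    Bipartite d →ₗ[ℂ] Bipartite d :=
  TensorProduct.map (Matrix.toLin' A) (Matrix.toLin' B)

/-- The shift matrix: `X|j⟩ = |j+1 mod d⟩`. -/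
def shiftX (d : ℕ) [NeZero d] : Matrix (ZMod d) (ZMod d) ℂ :=
  Matrix.of fun i j => if i = j + 1 then 1 else 0

/-- The clock matrix: `Z|j⟩ = ω^j|j⟩` with `ω = exp (2πi/d)`. -/
def clockZ (d : ℕ) [NeZero d] : Matrix (ZMod d) (ZMod d) ℂ :=
  Matrix.diagonal fun j => Complex.exp (2 * Real.pi * Complex.I / d) ^ j.val

/-- The generalized Pauli matrix `X^m Z^n`. -/
def gpm {d : ℕ} [NeZero d] (p : ZMod d × ZMod d) : Matrix (ZMod d) (ZMod d) ℂ :=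
  shiftX d ^ p.1.val * clockZ d ^ p.2.val

/-- The canonical maximally entangled state `(1/√d) ∑ j, |j⟩|j⟩`. -/
def maxEntangled (d : ℕ) [NeZero d] : Bipartite d :=
  ((1 / Real.sqrt d : ℝ) : ℂ) •
    ∑ j : ZMod d, (Pi.single j (1 : ℂ) : ZMod d → ℂ) ⊗ₜ[ℂ] (Pi.single j (1 : ℂ) : ZMod d → ℂ)

/-- The generalized Bell state `(I ⊗ X^m Z^n)|Φ⟩`. -/
def bell {d : ℕ} [NeZero d] (p : ZMod d × ZMod d) : Bipartite d :=
  localOp 1 (gpm p) (maxEntangled d)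

/-- Equality up to a global phase. -/
def PhaseEq {d : ℕ} (φ ψ : Bipartite d) : Prop := ∃ c : ℂ, ‖c‖ = 1 ∧ φ = c • ψ

/-- Local unitary equivalence of two sets of states. -/
def LUEquiv {d : ℕ} [NeZero d] (S T : Set (Bipartite d)) : Prop :=
  ∃ A ∈ Matrix.unitaryGroup (ZMod d) ℂ, ∃ B ∈ Matrix.unitaryGroup (ZMod d) ℂ,
    ∃ σ : S ≃ T, ∀ φ : S, PhaseEq (σ φ : Bipartite d) (localOp A B (φ : Bipartite d))

/-- The sets consisting of `n` generalized Bell states. -/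
def bellSets (d n : ℕ) [NeZero d] : Set (Set (Bipartite d)) :=
  {S | S ⊆ Set.range (bell (d := d)) ∧ S.ncard = n}

theorem localOp_one {d : ℕ} [NeZero d] (φ : Bipartite d) : localOp 1 1 φ = φ := by
  simp [localOp]

theorem localOp_mul {d : ℕ} [NeZero d] (A B A' B' : Matrix (ZMod d) (ZMod d) ℂ)
    (φ : Bipartite d) : localOp (A * A') (B * B') φ = localOp A B (localOp A' B' φ) := by
  simp only [localOp, Matrix.toLin'_mul, TensorProduct.map_comp, LinearMap.comp_apply]

theorem LUEquiv.refl {d : ℕ} [NeZero d] (S : Set (Bipartite d)) : LUEquiv S S :=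
  ⟨1, one_mem _, 1, one_mem _, Equiv.refl _, fun φ => ⟨1, by simp, by simp [localOp_one]⟩⟩

theorem LUEquiv.symm {d : ℕ} [NeZero d] {S T : Set (Bipartite d)} (h : LUEquiv S T) :
    LUEquiv T S := by
  obtain ⟨A, hA, B, hB, σ, h⟩ := h
  refine ⟨star A, Unitary.star_mem hA, star B, Unitary.star_mem hB, σ.symm, fun ψ => ?_⟩
  obtain ⟨c, hc, e⟩ := h (σ.symm ψ)
  have hc0 : c ≠ 0 := by
    rintro rfl
    simp at hc
  refine ⟨c⁻¹, by simp [hc], ?_⟩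
  rw [Equiv.apply_symm_apply] at e
  rw [e, map_smul, ← localOp_mul, Unitary.star_mul_self_of_mem hA,
    Unitary.star_mul_self_of_mem hB, localOp_one, smul_smul, inv_mul_cancel₀ hc0, one_smul]

theorem LUEquiv.trans {d : ℕ} [NeZero d] {S T R : Set (Bipartite d)} (h : LUEquiv S T)
    (h' : LUEquiv T R) : LUEquiv S R := by
  obtain ⟨A, hA, B, hB, σ, h⟩ := h
  obtain ⟨A', hA', B', hB', τ, h'⟩ := h'
  refine ⟨A' * A, mul_mem hA' hA, B' * B, mul_mem hB' hB, σ.trans τ, fun φ => ?_⟩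
  obtain ⟨c, hc, e⟩ := h φ
  obtain ⟨c', hc', e'⟩ := h' (σ φ)
  refine ⟨c' * c, by simp [hc, hc'], ?_⟩
  rw [Equiv.trans_apply, e', e, map_smul, localOp_mul, smul_smul]

/-- Local unitary equivalence as an equivalence relation on the `n`-element sets of
generalized Bell states. -/
def luSetoid (d n : ℕ) [NeZero d] : Setoid (bellSets d n) where
  r S T := LUEquiv (S : Set (Bipartite d)) (T : Set (Bipartite d))
  iseqv := ⟨fun S => LUEquiv.refl (S : Set (Bipartite d)), fun h => LUEquiv.symm h,
    fun h h' => LUEquiv.trans h h'⟩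

/-- The exponents of the 31 representatives; `(m, n)` stands for `X^m Z^n`. -/
def repExponents : Fin 31 → Set (ZMod 6 × ZMod 6) :=
  ![{(0, 0), (0, 1), (0, 2), (0, 3)},
    {(0, 0), (0, 1), (0, 2), (0, 4)},
    {(0, 0), (0, 1), (0, 2), (1, 0)},
    {(0, 0), (0, 1), (0, 2), (2, 0)},
    {(0, 0), (0, 1), (0, 2), (2, 1)},
    {(0, 0), (0, 1), (0, 2), (3, 0)},
    {(0, 0), (0, 1), (0, 2), (3, 1)},
    {(0, 0), (0, 1), (0, 3), (0, 4)},
    {(0, 0), (0, 1), (0, 3), (1, 0)},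
    {(0, 0), (0, 1), (0, 3), (2, 0)},
    {(0, 0), (0, 1), (0, 3), (2, 1)},
    {(0, 0), (0, 1), (0, 3), (3, 0)},
    {(0, 0), (0, 1), (0, 3), (3, 1)},
    {(0, 0), (0, 1), (0, 3), (5, 0)},
    {(0, 0), (0, 1), (1, 0), (1, 1)},
    {(0, 0), (0, 1), (1, 0), (1, 2)},
    {(0, 0), (0, 1), (1, 0), (1, 3)},
    {(0, 0), (0, 1), (1, 0), (2, 2)},
    {(0, 0), (0, 1), (1, 0), (3, 5)},
    {(0, 0), (0, 1), (1, 0), (4, 4)},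
    {(0, 0), (0, 1), (2, 0), (2, 1)},
    {(0, 0), (0, 1), (2, 0), (2, 2)},
    {(0, 0), (0, 1), (2, 0), (2, 5)},
    {(0, 0), (0, 1), (2, 0), (3, 1)},
    {(0, 0), (0, 1), (2, 0), (4, 0)},
    {(0, 0), (0, 1), (3, 0), (3, 1)},
    {(0, 0), (0, 1), (3, 0), (3, 3)},
    {(0, 0), (0, 1), (3, 0), (3, 5)},
    {(0, 0), (0, 2), (0, 4), (2, 0)},
    {(0, 0), (0, 2), (2, 0), (2, 2)},
    {(0, 0), (0, 3), (3, 0), (3, 3)}]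

/-- The 31 representatives as sets of generalized Bell states in `ℂ^6 ⊗ ℂ^6`. -/
def rep (i : Fin 31) : Set (Bipartite 6) := bell '' repExponents i

end GBS

end

noncomputable section

namespace GBS

variable {d : ℕ} [NeZero d]

/-! A vector of `ℂ^d ⊗ ℂ^d` is a matrix, a generalized Bell state is a multiple of X^m Z^n, and a
local unitary acts as M ↦ U M V (`luEquiv_bell_iff`). The question thus concerns four-point subsets
of the phase space (ℤ/6)², whose addition is the product of Pauli matrices up to a phase.

Existence: multiplication by a Pauli matrix translates the phase space, while the Fourier matrix and
a quadratic phase gate generate the action of SL₂(ℤ/6). So every affine symplectic map yields an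
LU-equivalence (`implementable_affineMap`). If two of the points differ by a unimodular vector, such
a map sends them to 0 and (0, 1), and a finite search over the other two points reaches a
representative. Sets without such a pair are searched separately (`exists_luEquiv_rep`).

Uniqueness: if an LU-equivalence sends a, b to a', b', then conjugation by U sends the Pauli matrix
of a - b to a multiple of that of a' - b'. Conjugation preserves commutation phases, hence the
symplectic form, and also the relation n • v = 0. The number `profile` is built from these data
alone, so it is invariant (`profile_eq_of_luEquiv`), and it separates the 31 representatives
(`profile_repFinset_injective`). -/

/-! ### Generalized Pauli matrices -/

theorem clockZ_eq : clockZ d = Matrix.diagonal fun j : ZMod d => ZMod.stdAddChar j := by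
  unfold clockZ
  congr 1
  funext j
  rw [← Complex.exp_nat_mul]
  conv_rhs => rw [← ZMod.natCast_zmod_val j, ← Int.cast_natCast (R := ZMod d)]
  rw [ZMod.stdAddChar_coe]
  congr 1
  push_cast
  ring

theorem shiftX_pow_apply (k : ℕ) (i j : ZMod d) :
    (shiftX d ^ k) i j = if i = j + k then 1 else 0 := by
  induction k generalizing i j with
  | zero => simp [Matrix.one_apply]
  | succ k ih =>
    rw [pow_succ, Matrix.mul_apply]
    have h (l : ZMod d) : shiftX d l j = if l = j + 1 then 1 else 0 := rfl
    simp [ih, h, add_assoc, add_comm (1 : ZMod d)]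

/-- The entries of a generalized Pauli matrix. -/
theorem gpm_apply (p : ZMod d × ZMod d) (i j : ZMod d) :
    gpm p i j = if i = j + p.1 then ZMod.stdAddChar (p.2 * j) else 0 := by
  rw [gpm, clockZ_eq, Matrix.diagonal_pow, Matrix.mul_diagonal, shiftX_pow_apply]
  have h : (ZMod.stdAddChar j : ℂ) ^ p.2.val = ZMod.stdAddChar (p.2 * j) := by
    rw [← AddChar.map_nsmul_eq_pow, nsmul_eq_mul, ZMod.natCast_zmod_val]
  simp [h]

theorem gpm_zero : gpm (0 : ZMod d × ZMod d) = 1 := by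
  ext i j
  simp [gpm_apply, Matrix.one_apply]

/-- The generalized Pauli matrices multiply up to a phase like the group `(ℤ/d)²`. -/
theorem gpm_mul_gpm (p q : ZMod d × ZMod d) :
    gpm p * gpm q = (ZMod.stdAddChar (p.2 * q.1) : ℂ) • gpm (p + q) := by
  ext i k
  rw [Matrix.mul_apply, Finset.sum_eq_single (k + q.1)]
  · simp only [gpm_apply, Matrix.smul_apply, smul_eq_mul, Prod.fst_add, Prod.snd_add, if_true]
    rw [add_assoc, add_comm q.1 p.1]
    split_ifs
    · rw [← AddChar.map_add_eq_mul, ← AddChar.map_add_eq_mul]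
      congr 1
      ring
    · simp
  · intro j _ hj
    simp [gpm_apply q, hj]
  · simp

theorem norm_stdAddChar (x : ZMod d) : ‖(ZMod.stdAddChar x : ℂ)‖ = 1 := by
  rw [ZMod.stdAddChar_apply]
  exact Circle.norm_coe _

theorem gpm_mem_unitaryGroup (p : ZMod d × ZMod d) :
    gpm p ∈ Matrix.unitaryGroup (ZMod d) ℂ := by
  rw [Matrix.mem_unitaryGroup_iff]
  ext i k
  rw [Matrix.mul_apply, Finset.sum_eq_single (i - p.1)]
  · simp only [gpm_apply, Matrix.star_apply, sub_add_cancel, if_true, Matrix.one_apply]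
    by_cases h : i = k
    · subst h
      simp [Complex.mul_conj, Complex.normSq_eq_norm_sq]
    · simp [h, Ne.symm h]
  · intro j _ hj
    have : i ≠ j + p.1 := fun h => hj (by simp [h])
    simp [gpm_apply p i, this]
  · simp

/-- Distinct generalized Pauli matrices are not proportional. -/
theorem eq_of_gpm_eq_smul {p q : ZMod d × ZMod d} {c : ℂ} (h : gpm p = c • gpm q) : p = q := by
  have e (j : ZMod d) := congrFun (congrFun h (j + p.1)) j
  simp only [gpm_apply, if_true, Matrix.smul_apply, smul_eq_mul] at e
  have h1 : p.1 = q.1 := by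
    by_contra hne
    have := e 0
    simp [hne] at this
  simp only [h1, if_true] at e
  -- Column 0 carries no phase and forces c = 1; column 1 then reads off the exponent of Z.
  have e0 := e 0
  have e1 := e 1
  simp only [mul_zero, AddChar.map_zero_eq_one, mul_one] at e0 e1
  rw [← e0, one_mul] at e1
  exact Prod.ext h1 (ZMod.injective_stdAddChar e1)

/-! ### From Bell states to matrices -/

/-- The coefficient matrix of a vector of `ℂ^d ⊗ ℂ^d`. -/
def coeffMatrix (d : ℕ) [NeZero d] : Bipartite d →ₗ[ℂ] Matrix (ZMod d) (ZMod d) ℂ :=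
  TensorProduct.lift (LinearMap.flip (vecMulVecBilin ℂ ℂ))

theorem coeffMatrix_tmul (x y : ZMod d → ℂ) :
    coeffMatrix d (x ⊗ₜ y) = Matrix.vecMulVec y x := rfl

/-- Both spaces have dimension d², so it is enough to hit every matrix unit. -/
theorem coeffMatrix_injective : Function.Injective (coeffMatrix d) := by
  have hs : Function.Surjective (coeffMatrix d) := by
    intro M
    refine ⟨∑ i, ∑ j, M i j • (Pi.single j (1 : ℂ) ⊗ₜ[ℂ] Pi.single i (1 : ℂ)), ?_⟩
    conv_rhs => rw [Matrix.matrix_eq_sum_single M]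
    simp only [map_sum, map_smul, coeffMatrix_tmul]
    refine Finset.sum_congr rfl fun i _ => Finset.sum_congr rfl fun j _ => ?_
    rw [← Matrix.single_eq_single_vecMulVec_single]
    simp
  refine (LinearMap.injective_iff_surjective_of_finrank_eq_finrank ?_).2 hs
  rw [Module.finrank_tensorProduct, Module.finrank_matrix]
  simp

theorem coeffMatrix_localOp (A B : Matrix (ZMod d) (ZMod d) ℂ) (φ : Bipartite d) :
    coeffMatrix d (localOp A B φ) = B * coeffMatrix d φ * A.transpose := by
  induction φ using TensorProduct.induction_on with
  | zero => simp
  | tmul x y =>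
    simp only [localOp, TensorProduct.map_tmul, coeffMatrix_tmul, Matrix.toLin'_apply]
    rw [Matrix.mul_vecMulVec, Matrix.vecMulVec_mul, Matrix.vecMul_transpose]
  | add x y hx hy => simp only [map_add, hx, hy, mul_add, add_mul]

theorem coeffMatrix_maxEntangled :
    coeffMatrix d (maxEntangled d) = ((1 / Real.sqrt d : ℝ) : ℂ) • 1 := by
  rw [maxEntangled, map_smul, map_sum]
  congr 1
  simp only [coeffMatrix_tmul, ← Matrix.single_eq_single_vecMulVec_single]
  exact Matrix.sum_single_one

theorem coeffMatrix_bell (p : ZMod d × ZMod d) :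
    coeffMatrix d (bell p) = ((1 / Real.sqrt d : ℝ) : ℂ) • gpm p := by
  rw [bell, coeffMatrix_localOp, coeffMatrix_maxEntangled]
  simp

theorem phaseEq_bell_localOp_iff (A B : Matrix (ZMod d) (ZMod d) ℂ) (p q : ZMod d × ZMod d) :
    PhaseEq (bell q) (localOp A B (bell p)) ↔
      ∃ c : ℂ, ‖c‖ = 1 ∧ gpm q = c • (B * gpm p * A.transpose) := by
  have hd : ((1 / Real.sqrt d : ℝ) : ℂ) ≠ 0 := by
    have : (0 : ℝ) < d := Nat.cast_pos.2 (NeZero.pos d)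
    exact Complex.ofReal_ne_zero.2 (by positivity)
  refine exists_congr fun c => and_congr_right fun _ => ?_
  rw [← coeffMatrix_injective.eq_iff, map_smul, coeffMatrix_localOp, coeffMatrix_bell,
    coeffMatrix_bell, Matrix.mul_smul, Matrix.smul_mul, smul_comm]
  exact (smul_right_injective _ hd).eq_iff

theorem bell_injective : Function.Injective (bell (d := d)) := by
  intro p q h
  obtain ⟨c, -, hc⟩ := (phaseEq_bell_localOp_iff 1 1 q p).1
    ⟨1, by simp, by rw [localOp_one, h, one_smul]⟩
  exact eq_of_gpm_eq_smul (c := c) (by simpa using hc)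

/-- Local unitary equivalence of two sets of generalized Bell states in terms of their matrices. -/
theorem luEquiv_bell_iff (S T : Set (ZMod d × ZMod d)) :
    LUEquiv (bell '' S) (bell '' T) ↔
      ∃ U ∈ Matrix.unitaryGroup (ZMod d) ℂ, ∃ V ∈ Matrix.unitaryGroup (ZMod d) ℂ,
        ∃ σ : S ≃ T, ∀ a : S, ∃ c : ℂ, ‖c‖ = 1 ∧
          gpm (σ a : ZMod d × ZMod d) = c • (U * gpm (a : ZMod d × ZMod d) * V) := by
  let eS := Equiv.Set.image bell S bell_injective
  let eT := Equiv.Set.image bell T bell_injective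
  constructor
  · rintro ⟨A, hA, B, hB, σ, h⟩
    refine ⟨B, hB, A.transpose, Matrix.transpose_mem_unitaryGroup_iff.2 hA,
      (eS.trans σ).trans eT.symm, fun a => ?_⟩
    rw [← phaseEq_bell_localOp_iff]
    have := h (eS a)
    rwa [← eT.apply_symm_apply (σ (eS a))] at this
  · rintro ⟨U, hU, V, hV, σ, h⟩
    refine ⟨V.transpose, Matrix.transpose_mem_unitaryGroup_iff.2 hV, U, hU,
      (eS.symm.trans σ).trans eT, fun φ => ?_⟩
    obtain ⟨a, rfl⟩ := eS.surjective φ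
    rw [Equiv.trans_apply, Equiv.trans_apply, Equiv.symm_apply_apply]
    exact (phaseEq_bell_localOp_iff V.transpose U _ _).2 (by simpa using h a)

/-! ### Conjugation of Pauli matrices -/

/-- Conjugation by `U` maps the generalized Pauli matrix `v` to a multiple of `w`. -/
def PauliConj (U : Matrix (ZMod d) (ZMod d) ℂ) (v w : ZMod d × ZMod d) : Prop :=
  ∃ c : ℂ, c ≠ 0 ∧ U * gpm v = c • (gpm w * U)

theorem stdAddChar_ne_zero (x : ZMod d) : (ZMod.stdAddChar x : ℂ) ≠ 0 := by
  rw [← norm_ne_zero_iff, norm_stdAddChar]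
  exact one_ne_zero

theorem isUnit_of_mem_unitaryGroup {U : Matrix (ZMod d) (ZMod d) ℂ}
    (hU : U ∈ Matrix.unitaryGroup (ZMod d) ℂ) : IsUnit U :=
  (Unitary.toUnits ⟨U, hU⟩).isUnit

theorem isUnit_gpm (p : ZMod d × ZMod d) : IsUnit (gpm p) :=
  isUnit_of_mem_unitaryGroup (gpm_mem_unitaryGroup p)

namespace PauliConj

variable {U : Matrix (ZMod d) (ZMod d) ℂ} {v w v' w' : ZMod d × ZMod d}

theorem zero (U : Matrix (ZMod d) (ZMod d) ℂ) : PauliConj U 0 0 :=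
  ⟨1, one_ne_zero, by simp [gpm_zero]⟩

theorem mul_gpm_mul {c c' : ℂ} (h : U * gpm v = c • (gpm w * U))
    (h' : U * gpm v' = c' • (gpm w' * U)) :
    U * (gpm v * gpm v') = (c * c') • (gpm w * gpm w' * U) := by
  rw [← mul_assoc, h, smul_mul_assoc, mul_assoc, h', mul_smul_comm, smul_smul, mul_assoc]

theorem add (h : PauliConj U v w) (h' : PauliConj U v' w') : PauliConj U (v + v') (w + w') := by
  obtain ⟨c, hc, h⟩ := h
  obtain ⟨c', hc', h'⟩ := h'
  have e := mul_gpm_mul h h'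
  rw [gpm_mul_gpm, gpm_mul_gpm, mul_smul_comm, smul_mul_assoc, smul_smul] at e
  refine ⟨(ZMod.stdAddChar (v.2 * v'.1))⁻¹ * (c * c' * ZMod.stdAddChar (w.2 * w'.1)),
    mul_ne_zero (inv_ne_zero (stdAddChar_ne_zero _))
      (mul_ne_zero (mul_ne_zero hc hc') (stdAddChar_ne_zero _)), ?_⟩
  rw [mul_smul, ← e, smul_smul, inv_mul_cancel₀ (stdAddChar_ne_zero _), one_smul]

theorem nsmul (h : PauliConj U v w) (n : ℕ) : PauliConj U (n • v) (n • w) := by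
  induction n with
  | zero => simpa using zero U
  | succ n ih => rw [succ_nsmul, succ_nsmul]; exact ih.add h

theorem eq_zero_iff (hU : IsUnit U) (h : PauliConj U v w) : v = 0 ↔ w = 0 := by
  obtain ⟨c, hc, h⟩ := h
  constructor
  · rintro rfl
    rw [gpm_zero, mul_one, ← smul_mul_assoc] at h
    refine (eq_of_gpm_eq_smul (c := c) ?_).symm
    rw [gpm_zero]
    exact hU.mul_right_cancel (by rw [← h, one_mul])
  · rintro rfl
    rw [gpm_zero, one_mul] at h
    refine eq_of_gpm_eq_smul (c := c) ?_
    rw [gpm_zero]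
    exact hU.mul_left_cancel (by rw [h, mul_smul_comm, mul_one])

/-- Conjugation preserves the symplectic form. -/
theorem symplectic_eq (hU : IsUnit U) (h : PauliConj U v w) (h' : PauliConj U v' w') :
    v.1 * v'.2 - v.2 * v'.1 = w.1 * w'.2 - w.2 * w'.1 := by
  obtain ⟨c, hc, h⟩ := h
  obtain ⟨c', hc', h'⟩ := h'
  -- The form appears as the commutation phase. Applying U to both orders of the product equates the
  -- two phases, because `stdAddChar` is injective.
  have comm (p q : ZMod d × ZMod d) :
      gpm q * gpm p = (ZMod.stdAddChar (p.1 * q.2 - p.2 * q.1) : ℂ) • (gpm p * gpm q) := by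
    rw [gpm_mul_gpm, gpm_mul_gpm, smul_smul, ← AddChar.map_add_eq_mul, add_comm q p]
    congr 2
    ring
  have e := mul_gpm_mul h h'
  have e' := mul_gpm_mul h' h
  rw [comm v v', comm w w', mul_smul_comm, e, smul_mul_assoc, smul_smul, smul_smul,
    mul_comm c' c, mul_comm (ZMod.stdAddChar _)] at e'
  have hne : gpm w * gpm w' * U ≠ 0 := (((isUnit_gpm w).mul (isUnit_gpm w')).mul hU).ne_zero
  exact ZMod.injective_stdAddChar
    (mul_left_cancel₀ (mul_ne_zero hc hc') (smul_left_injective ℂ hne e'))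

/-- Up to a phase, the matrix of a - b is that of a times the inverse of that of b, and in this
quotient the right factor V cancels. Passing to differences thus turns a two-sided multiplication
into a conjugation. -/
theorem of_eq_smul {V : Matrix (ZMod d) (ZMod d) ℂ} (hV : IsUnit V)
    {a b a' b' : ZMod d × ZMod d} {c k : ℂ} (hc : c ≠ 0) (hk : k ≠ 0)
    (ha : gpm a' = c • (U * gpm a * V)) (hb : gpm b' = k • (U * gpm b * V)) :
    PauliConj U (a - b) (a' - b') := by
  have e (p q : ZMod d × ZMod d) :
      gpm (p - q) * gpm q = (ZMod.stdAddChar ((p - q).2 * q.1) : ℂ) • gpm p := by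
    rw [gpm_mul_gpm, sub_add_cancel]
  have e1 := e a b
  have e2 := e a' b'
  set s : ℂ := ZMod.stdAddChar ((a - b).2 * b.1)
  set s' : ℂ := ZMod.stdAddChar ((a' - b').2 * b'.1)
  have hs : s ≠ 0 := stdAddChar_ne_zero _
  have hs' : s' ≠ 0 := stdAddChar_ne_zero _
  refine ⟨s * (k * (s' * c)⁻¹), by simp [hs, hk, hs', hc], ?_⟩
  refine ((isUnit_gpm b).mul hV).mul_right_cancel ?_
  rw [ha, hb, mul_smul_comm, smul_smul] at e2
  calc U * gpm (a - b) * (gpm b * V) = U * (gpm (a - b) * gpm b) * V := by simp only [mul_assoc]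
    _ = s • (U * gpm a * V) := by rw [e1, mul_smul_comm, smul_mul_assoc]
    _ = (s * (s' * c)⁻¹) • ((s' * c) • (U * gpm a * V)) := by
      rw [smul_smul, inv_mul_cancel_right₀ (mul_ne_zero hs' hc)]
    _ = (s * (k * (s' * c)⁻¹)) • (gpm (a' - b') * U * (gpm b * V)) := by
      rw [← e2, smul_smul]
      congr 1
      · ring
      · simp only [mul_assoc]
    _ = _ := by rw [smul_mul_assoc]

end PauliConj

/-! ### The numerical invariant -/

/-- The (oriented, doubled) area of a triangle in the discrete phase space. -/
def area (a b c : ZMod d × ZMod d) : ZMod d :=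
  (b - a).1 * (c - a).2 - (b - a).2 * (c - a).1

/-- The number of `n < d` that annihilate `v`. -/
def torsionCount (v : ZMod d × ZMod d) : ℕ := ((Finset.range d).filter fun n => n • v = 0).card

/-- A numerical invariant of a finite set of generalized Bell states. -/
def profile (S : Finset (ZMod d × ZMod d)) : ℕ :=
  -- Invariance needs only that the summand depends on areas and torsion; the bases 5 and 2 matter
  -- only in that the resulting values separate the representatives.
  ∑ a ∈ S, ∑ b ∈ S, ∑ c ∈ S, ∑ e ∈ S,
    5 ^ (area a b c).val * 2 ^ ((area a b e).val + (area a c e).val) * torsionCount (a - b)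

/-- The profile is invariant under local unitary equivalence. -/
theorem profile_eq_of_luEquiv {S T : Finset (ZMod d × ZMod d)}
    (h : LUEquiv (bell '' (S : Set (ZMod d × ZMod d))) (bell '' (T : Set (ZMod d × ZMod d)))) :
    profile S = profile T := by
  obtain ⟨U, hU, V, hV, σ, h⟩ := (luEquiv_bell_iff _ _).1 h
  have hU' := isUnit_of_mem_unitaryGroup hU
  have key (a b : S) : PauliConj U (a.1 - b.1) ((σ a).1 - (σ b).1) := by
    obtain ⟨c, hc, ha⟩ := h a
    obtain ⟨k, hk, hb⟩ := h b
    exact .of_eq_smul (isUnit_of_mem_unitaryGroup hV) (norm_ne_zero_iff.1 (by simp [hc]))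
      (norm_ne_zero_iff.1 (by simp [hk])) ha hb
  have harea (a b c : S) : area (σ a).1 (σ b).1 (σ c).1 = area a.1 b.1 c.1 :=
    ((key b a).symplectic_eq hU' (key c a)).symm
  have htors (a b : S) : torsionCount ((σ a).1 - (σ b).1) = torsionCount (a.1 - b.1) := by
    unfold torsionCount
    congr 1
    exact Finset.filter_congr fun n _ => (((key a b).nsmul n).eq_zero_iff hU').symm
  have hsum (f : ZMod d × ZMod d → ℕ) : ∑ b ∈ T, f b = ∑ a : S, f (σ a).1 := by
    rw [← Finset.sum_coe_sort T f]
    exact (Equiv.sum_comp σ fun b : T => f b).symm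
  have hsum' (f : ZMod d × ZMod d → ℕ) : ∑ b ∈ S, f b = ∑ a : S, f a :=
    (Finset.sum_coe_sort S f).symm
  unfold profile
  simp only [hsum, hsum']
  simp only [harea, htors]

/-! ### Affine symplectic maps implemented by unitaries -/

/-- A transformation of the phase space that is implemented by a pair of unitaries. -/
def Implementable (g : ZMod d × ZMod d → ZMod d × ZMod d) : Prop :=
  ∃ U ∈ Matrix.unitaryGroup (ZMod d) ℂ, ∃ V ∈ Matrix.unitaryGroup (ZMod d) ℂ,
    ∀ p, ∃ c : ℂ, ‖c‖ = 1 ∧ gpm (g p) = c • (U * gpm p * V)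

namespace Implementable

variable {f g : ZMod d × ZMod d → ZMod d × ZMod d}

theorem comp (hf : Implementable f) (hg : Implementable g) : Implementable (f ∘ g) := by
  obtain ⟨U, hU, V, hV, hf⟩ := hf
  obtain ⟨U', hU', V', hV', hg⟩ := hg
  refine ⟨U * U', mul_mem hU hU', V' * V, mul_mem hV' hV, fun p => ?_⟩
  obtain ⟨c, hc, e⟩ := hf (g p)
  obtain ⟨c', hc', e'⟩ := hg p
  refine ⟨c * c', by simp [hc, hc'], ?_⟩
  rw [Function.comp_apply, e, e', mul_smul_comm, smul_mul_assoc, smul_smul]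
  simp only [mul_assoc]

theorem id : Implementable (id : ZMod d × ZMod d → ZMod d × ZMod d) :=
  ⟨1, one_mem _, 1, one_mem _, fun p => ⟨1, by simp, by simp⟩⟩

theorem iterate (hf : Implementable f) (n : ℕ) : Implementable f^[n] := by
  induction n with
  | zero => exact id
  | succ n ih => exact ih.comp hf

theorem injective (hf : Implementable f) : Function.Injective f := by
  obtain ⟨U, hU, V, hV, h⟩ := hf
  intro p q hpq
  obtain ⟨c, hc, e⟩ := h p
  obtain ⟨k, -, e'⟩ := h q
  have hc0 : c ≠ 0 := norm_ne_zero_iff.1 (by simp [hc])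
  refine eq_of_gpm_eq_smul (c := c⁻¹ * k) ?_
  refine (isUnit_of_mem_unitaryGroup hU).mul_left_cancel
    ((isUnit_of_mem_unitaryGroup hV).mul_right_cancel ?_)
  rw [mul_smul_comm, smul_mul_assoc, mul_smul, ← e', ← hpq, e, smul_smul, inv_mul_cancel₀ hc0,
    one_smul]

theorem luEquiv (hf : Implementable f) (S : Set (ZMod d × ZMod d)) :
    LUEquiv (bell '' S) (bell '' (f '' S)) := by
  have hinj := hf.injective
  obtain ⟨U, hU, V, hV, h⟩ := hf
  exact (luEquiv_bell_iff _ _).2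
    ⟨U, hU, V, hV, Equiv.Set.image f S hinj, fun a => h a⟩

theorem of_mul_eq {U : Matrix (ZMod d) (ZMod d) ℂ} (hU : U ∈ Matrix.unitaryGroup (ZMod d) ℂ)
    (h : ∀ p, ∃ c : ℂ, ‖c‖ = 1 ∧ gpm (f p) * U = c • (U * gpm p)) : Implementable f := by
  refine ⟨U, hU, star U, Unitary.star_mem hU, fun p => ?_⟩
  obtain ⟨c, hc, e⟩ := h p
  refine ⟨c, hc, ?_⟩
  rw [← smul_mul_assoc, ← e, mul_assoc, Unitary.mul_star_self_of_mem hU, mul_one]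

theorem translation (u : ZMod d × ZMod d) : Implementable fun p => p + u := by
  refine ⟨1, one_mem _, gpm u, gpm_mem_unitaryGroup u, fun p => ?_⟩
  refine ⟨(ZMod.stdAddChar (p.2 * u.1))⁻¹, by simp, ?_⟩
  rw [one_mul, gpm_mul_gpm, smul_smul, inv_mul_cancel₀ (stdAddChar_ne_zero _), one_smul]

/-- The discrete Fourier transform implements the rotation of the phase space. -/
theorem rotation : Implementable fun p : ZMod d × ZMod d => (-p.2, p.1) := by
  have hd : (0 : ℝ) < d := Nat.cast_pos.2 (NeZero.pos d)
  let s : ℂ := ((Real.sqrt d)⁻¹ : ℝ)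
  have hs : s * s * d = 1 := by
    have : (Real.sqrt d)⁻¹ * (Real.sqrt d)⁻¹ * d = 1 := by
      rw [← mul_inv, Real.mul_self_sqrt hd.le, inv_mul_cancel₀ hd.ne']
    simp only [s]
    exact_mod_cast this
  let F : Matrix (ZMod d) (ZMod d) ℂ := Matrix.of fun k j => s * ZMod.stdAddChar (k * j)
  have hF : F ∈ Matrix.unitaryGroup (ZMod d) ℂ := by
    rw [Matrix.mem_unitaryGroup_iff]
    ext k l
    have hstar (x : ZMod d) : star (ZMod.stdAddChar x : ℂ) = ZMod.stdAddChar (-x) := by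
      rw [ZMod.stdAddChar_apply, ZMod.stdAddChar_apply, AddChar.map_neg_eq_inv,
        Circle.coe_inv_eq_conj]
      rfl
    have hterm (j : ZMod d) :
        F k j * (star F) j l = s * s * ZMod.stdAddChar (j * (k - l)) := by
      have hss : star s = s := Complex.conj_ofReal _
      rw [Matrix.star_apply]
      simp only [F, Matrix.of_apply, star_mul', hstar, hss]
      rw [show j * (k - l) = k * j + -(l * j) by ring, AddChar.map_add_eq_mul]
      ring
    rw [Matrix.mul_apply]
    simp only [hterm]
    -- Orthogonality of characters: the sum over j is d if k = l and 0 otherwise.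
    rw [← Finset.mul_sum, AddChar.sum_mulShift _ (ZMod.isPrimitive_stdAddChar d),
      Matrix.one_apply]
    by_cases h : k = l
    · simp [h, hs]
    · simp [h, sub_eq_zero]
  refine of_mul_eq hF fun p => ⟨ZMod.stdAddChar (p.1 * p.2), norm_stdAddChar _, ?_⟩
  ext k j
  rw [Matrix.smul_apply, Matrix.mul_apply, Matrix.mul_apply, Finset.sum_eq_single (k + p.2),
    Finset.sum_eq_single (j + p.1)]
  · simp only [F, gpm_apply, Matrix.of_apply, smul_eq_mul, add_neg_cancel_right, if_true]
    rw [mul_left_comm, ← AddChar.map_add_eq_mul, mul_assoc s, mul_left_comm _ s,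
      ← AddChar.map_add_eq_mul, ← AddChar.map_add_eq_mul]
    congr 2
    ring
  · intro l _ hl
    simp [gpm_apply p, hl]
  · simp
  · intro l _ hl
    have : k ≠ l + -p.2 := fun h => hl (by simp [h])
    simp [gpm_apply, this]
  · simp

/-- Take θ j = exp(πi j²/d). Replacing j by j + d adds πi(2j + d) to the exponent, a multiple of 2πi
exactly because d is even. -/
theorem exists_quadratic_phase (hd : Even d) :
    ∃ θ : ZMod d → ℂ, (∀ j, ‖θ j‖ = 1) ∧
      ∀ j m, θ (j + m) = θ j * θ m * ZMod.stdAddChar (j * m) := by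
  have hd0 : (d : ℂ) ≠ 0 := Nat.cast_ne_zero.2 (NeZero.ne d)
  let e : ℕ → ℂ := fun n => Complex.exp (Real.pi * Complex.I * n ^ 2 / d)
  have hper : Function.Periodic e d := by
    intro n
    obtain ⟨k, hk⟩ := hd
    have hk' : (d : ℂ) = 2 * k := by rw [hk]; push_cast; ring
    simp only [e]
    rw [Complex.exp_eq_exp_iff_exists_int]
    refine ⟨n + k, ?_⟩
    push_cast
    field_simp
    rw [hk']
    ring
  refine ⟨fun j => e j.val, fun j => ?_, fun j m => ?_⟩
  · have : Real.pi * Complex.I * (j.val : ℂ) ^ 2 / d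
        = ((Real.pi * (j.val : ℝ) ^ 2 / d : ℝ) : ℂ) * Complex.I := by
      push_cast
      ring
    simp only [e, this]
    exact Complex.norm_exp_ofReal_mul_I _
  · have hψ : (ZMod.stdAddChar (j * m) : ℂ)
        = Complex.exp (2 * Real.pi * Complex.I * (j.val * m.val : ℕ) / d) := by
      have := ZMod.stdAddChar_coe (N := d) ((j.val * m.val : ℕ) : ℤ)
      rw [← Int.cast_natCast (R := ℂ), ← this]
      simp
    change e (j + m).val = e j.val * e m.val * _
    rw [ZMod.val_add, hper.map_mod_nat, hψ]
    simp only [e]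
    rw [← Complex.exp_add, ← Complex.exp_add]
    congr 1
    push_cast
    ring

/-- In even dimension a quadratic phase gate implements the shear of the phase space. -/
theorem shear (hd : Even d) : Implementable fun p : ZMod d × ZMod d => (p.1, p.1 + p.2) := by
  obtain ⟨θ, hθ, hadd⟩ := exists_quadratic_phase (d := d) hd
  have hθ0 (j : ZMod d) : θ j ≠ 0 := norm_ne_zero_iff.1 (by simp [hθ])
  have hD : Matrix.diagonal θ ∈ Matrix.unitaryGroup (ZMod d) ℂ := by
    rw [Matrix.mem_unitaryGroup_iff, Matrix.star_eq_conjTranspose,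
      Matrix.diagonal_conjTranspose, Matrix.diagonal_mul_diagonal, ← Matrix.diagonal_one]
    congr 1
    funext j
    simp [Complex.mul_conj, Complex.normSq_eq_norm_sq, hθ]
  refine of_mul_eq hD fun p => ⟨(θ p.1)⁻¹, by simp [hθ], ?_⟩
  ext i j
  rw [Matrix.mul_diagonal, Matrix.smul_apply, Matrix.diagonal_mul, gpm_apply, gpm_apply]
  split_ifs with h
  · rw [h, hadd, smul_eq_mul, add_mul, AddChar.map_add_eq_mul, mul_comm j p.1]
    field_simp [hθ0]
  · simp

theorem lowerShear (hd : Even d) (k : ZMod d) :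
    Implementable fun p : ZMod d × ZMod d => (p.1, k * p.1 + p.2) := by
  convert (shear hd).iterate k.val using 1
  have h (n : ℕ) : (fun p : ZMod d × ZMod d => (p.1, p.1 + p.2))^[n]
      = fun p : ZMod d × ZMod d => (p.1, n * p.1 + p.2) := by
    induction n with
    | zero => funext p; simp
    | succ n ih =>
      rw [Function.iterate_succ, ih]
      funext p
      simp only [Function.comp_apply, Nat.cast_succ]
      congr 1
      ring
  rw [h, ZMod.natCast_zmod_val]

theorem neg : Implementable fun p : ZMod d × ZMod d => -p := by
  convert rotation.comp (rotation (d := d)) using 1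
  funext p
  simp [Prod.ext_iff]

/-- Conjugate a lower shear by the rotation; `neg.comp rotation` is the inverse rotation, as the
rotation squares to -1. -/
theorem upperShear (hd : Even d) (k : ZMod d) :
    Implementable fun p : ZMod d × ZMod d => (p.1 + k * p.2, p.2) := by
  convert ((rotation (d := d)).comp (lowerShear hd (-k))).comp (neg.comp rotation) using 1
  funext p
  simp [add_comm]

end Implementable

/-- The affine map of the phase space with linear part `!![p, q; r, s]` and translation `u`. -/
def affineMap (p q r s : ZMod d) (u x : ZMod d × ZMod d) : ZMod d × ZMod d :=
  (p * x.1 + q * x.2, r * x.1 + s * x.2) + u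

/-- Adding k times the second column to the first makes the top left entry 1. A matrix of
determinant 1 with that entry is a lower shear times an upper shear. -/
theorem implementable_of_exists (hd : Even d) {p q r s k : ZMod d} (hdet : p * s - q * r = 1)
    (hk : p + k * q = 1) (u : ZMod d × ZMod d) : Implementable (affineMap p q r s u) := by
  convert (Implementable.translation u).comp
    (((Implementable.lowerShear hd (r + k * s)).comp (.upperShear hd q)).comp
      (.lowerShear hd (-k))) using 1
  funext x
  simp only [affineMap, Function.comp_apply]
  congr 2
  · linear_combination x.1 * hk
  · linear_combination (x.2 - k * x.1) * hdet + (s * k * x.1 - s * x.2) * hk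

/-- A first row of determinant 1 is unimodular, and ℤ/6 has stable rank one, so some p + k q is a
unit; the units are ±1. -/
theorem exists_unit_combination : ∀ p q r s : ZMod 6, p * s - q * r = 1 →
    ∃ k, p + k * q = 1 ∨ p + k * q = -1 := by
  decide +kernel

/-- Every affine symplectic map of the phase space `(ℤ/6)²` is implementable. -/
theorem implementable_affineMap {p q r s : ZMod 6} (hdet : p * s - q * r = 1)
    (u : ZMod 6 × ZMod 6) : Implementable (affineMap p q r s u) := by
  have hd : Even 6 := by decide
  obtain ⟨k, hk | hk⟩ := exists_unit_combination p q r s hdet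
  · exact implementable_of_exists hd hdet hk u
  · have := (Implementable.translation u).comp ((implementable_of_exists hd (p := -p) (q := -q)
      (r := -r) (s := -s) (k := k) (by linear_combination hdet) (by linear_combination -hk)
      0).comp .neg)
    convert this using 1
    funext x
    simp [affineMap]

/-! ### Normalization along a unimodular direction -/

/-- A direction in the phase space `(ℤ/6)²` is unimodular if its entries generate the unit
ideal. -/
def Unimodular (v : ZMod 6 × ZMod 6) : Prop := v.1 ^ 2 + v.2 ^ 2 - v.1 ^ 2 * v.2 ^ 2 = 1

/-- For unimodular `v`, these are the affine symplectic maps with `a ↦ 0` and `a + v ↦ (0, 1)`. -/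
def normalize (v a : ZMod 6 × ZMod 6) (k : ZMod 6) (x : ZMod 6 × ZMod 6) : ZMod 6 × ZMod 6 :=
  affineMap v.2 (-v.1) (v.1 + k * v.2) (v.2 * (1 - v.1 ^ 2) - k * v.1) 0 (x - a)

theorem implementable_normalize {v : ZMod 6 × ZMod 6} (hv : Unimodular v) (a : ZMod 6 × ZMod 6)
    (k : ZMod 6) : Implementable (normalize v a k) := by
  -- The terms in k cancel and leave the polynomial of `Unimodular`. Squares in ℤ/6 are idempotent,
  -- so this polynomial is the idempotent generating the ideal of the two entries.
  have hdet : v.2 * (v.2 * (1 - v.1 ^ 2) - k * v.1) - -v.1 * (v.1 + k * v.2) = 1 := by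
    unfold Unimodular at hv
    linear_combination hv
  convert (implementable_affineMap hdet 0).comp (.translation (-a)) using 1
  funext x
  simp only [normalize, Function.comp_apply, sub_eq_add_neg]

/-! ### Codes and the search -/

/-- The point of the phase space `(ℤ/6)²` with code `6 * m + n`. -/
def point (c : ℕ) : ZMod 6 × ZMod 6 := ((c / 6 : ℕ), (c : ℕ))

def code (x : ZMod 6 × ZMod 6) : ℕ := 6 * x.1.val + x.2.val

theorem code_lt (x : ZMod 6 × ZMod 6) : code x < 36 := by
  have h1 := ZMod.val_lt x.1
  have h2 := ZMod.val_lt x.2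
  unfold code
  omega

theorem point_code (x : ZMod 6 × ZMod 6) : point (code x) = x := by
  have h2 := ZMod.val_lt x.2
  have h3 : code x / 6 = x.1.val := by
    unfold code
    omega
  refine Prod.ext ?_ ?_
  · simp [point, h3]
  · have h6 : (6 : ZMod 6) = 0 := by decide
    simp [point, code, h6]

theorem code_injective : Function.Injective code :=
  Function.LeftInverse.injective point_code

/-- The points of the phase space given by a list of codes. -/
def points (L : List ℕ) : Set (ZMod 6 × ZMod 6) := {x | ∃ c ∈ L, point c = x}

/-- The representatives in terms of codes. -/
def repCodes : List (List ℕ) :=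
  [[0, 1, 2, 3], [0, 1, 2, 4], [0, 1, 2, 6], [0, 1, 2, 12], [0, 1, 2, 13], [0, 1, 2, 18],
   [0, 1, 2, 19], [0, 1, 3, 4], [0, 1, 3, 6], [0, 1, 3, 12], [0, 1, 3, 13], [0, 1, 3, 18],
   [0, 1, 3, 19], [0, 1, 3, 30], [0, 1, 6, 7], [0, 1, 6, 8], [0, 1, 6, 9], [0, 1, 6, 14],
   [0, 1, 6, 23], [0, 1, 6, 28], [0, 1, 12, 13], [0, 1, 12, 14], [0, 1, 12, 17], [0, 1, 12, 19],
   [0, 1, 12, 24], [0, 1, 18, 19], [0, 1, 18, 21], [0, 1, 18, 23], [0, 2, 4, 12],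
   [0, 2, 12, 14], [0, 3, 18, 21]]

theorem points_four (a b c e : ℕ) :
    points [a, b, c, e] = {point a, point b, point c, point e} := by
  ext x
  simp [points, eq_comm]

theorem points_repCodes (i : Fin 31) : points (repCodes.get i) = repExponents i := by
  fin_cases i <;> exact points_four _ _ _ _

/-- Evaluates `n` to a numeral before it is passed to `f`. -/
def force (n : ℕ) (f : ℕ → Bool) : Bool := Nat.rec (f 0) (fun k _ => f k.succ) n

theorem force_eq (n : ℕ) (f : ℕ → Bool) : force n f = f n := by
  cases n <;> rfl

/-- The bit mask of a list of codes. -/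
def mask : List ℕ → ℕ
  | [] => 0
  | c :: L => Nat.lor (2 ^ c) (mask L)

theorem testBit_mask (L : List ℕ) (c : ℕ) : (mask L).testBit c = decide (c ∈ L) := by
  induction L with
  | nil => simp [mask]
  | cons e L ih =>
    change ((2 ^ e ||| mask L).testBit c) = _
    rw [Nat.testBit_or, ih, Nat.testBit_two_pow]
    simp [eq_comm]

theorem points_eq_of_mask_eq {L R : List ℕ} (h : mask L = mask R) : points L = points R := by
  have hmem (c : ℕ) : c ∈ L ↔ c ∈ R := by
    have := congrArg (fun n => n.testBit c) h
    simpa [testBit_mask] using this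
  simp only [points, hmem]

def isRep (L : List ℕ) : Bool :=
  force (mask L) fun k => repCodes.any fun R => Nat.beq (mask R) k

theorem exists_of_isRep {L : List ℕ} (h : isRep L = true) : ∃ i, points L = repExponents i := by
  rw [isRep, force_eq, List.any_eq_true] at h
  obtain ⟨R, hR, h⟩ := h
  obtain ⟨i, rfl⟩ := List.mem_iff_get.1 hR
  exact ⟨i, (points_eq_of_mask_eq (Nat.eq_of_beq_eq_true h)).symm.trans (points_repCodes i)⟩

/-- Adding 6 before subtracting avoids truncation for codes below 36. In the definitions that
follow, 5 stands for -1. -/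
def diffCode (a b : ℕ) : ℕ := (b / 6 + 6 - a / 6) % 6 * 6 + (b % 6 + 6 - a % 6) % 6

def unimodularCode (m n : ℕ) : Bool :=
  Nat.beq ((m * m + n * n + 5 * (m * m * (n * n))) % 6) 1

def normalizeCode (m n r s a c : ℕ) : ℕ :=
  (n * (c / 6 + 6 - a / 6) + 5 * m * (c % 6 + 6 - a % 6)) % 6 * 6 +
    (r * (c / 6 + 6 - a / 6) + s * (c % 6 + 6 - a % 6)) % 6

def searchFrom (L : List ℕ) (a m n : ℕ) : Bool :=
  unimodularCode m n && (List.range 6).any fun k =>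
    force ((m + k * n) % 6) fun r => force ((n * (1 + 5 * (m * m)) + 5 * (k * m)) % 6) fun s =>
      isRep (L.map (normalizeCode m n r s a))

/-- Looks for a representative among the normalizations of the points `L` along the directions
`dir a b`. -/
def search (dir : ℕ → ℕ → ℕ) (L : List ℕ) : Bool :=
  isRep L || L.any fun a => L.any fun b =>
    force (dir a b) fun e => force (e / 6) fun m => force (e % 6) fun n => searchFrom L a m n

theorem point_mod (x y : ℕ) : point (x % 6 * 6 + y % 6) = ((x : ZMod 6), (y : ZMod 6)) := by
  have h : (x % 6 * 6 + y % 6) / 6 = x % 6 := by omega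
  have h6 : (6 : ZMod 6) = 0 := by decide
  have hx : ((x % 6 : ℕ) : ZMod 6) = x := ZMod.natCast_mod x 6
  have hy : ((y % 6 : ℕ) : ZMod 6) = y := ZMod.natCast_mod y 6
  refine Prod.ext ?_ ?_
  · simp only [point, h, hx]
  · simp only [point, Nat.cast_add, Nat.cast_mul, hy, Nat.cast_ofNat, h6, mul_zero, zero_add]

theorem cast_sub_div {a : ℕ} (ha : a < 36) (b : ℕ) :
    ((b / 6 + 6 - a / 6 : ℕ) : ZMod 6) = (point b - point a).1 := by
  have h6 : (6 : ZMod 6) = 0 := by decide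
  rw [Nat.cast_sub (by omega)]
  simp [point, h6]

theorem cast_sub_mod (a b : ℕ) :
    ((b % 6 + 6 - a % 6 : ℕ) : ZMod 6) = (point b - point a).2 := by
  have h6 : (6 : ZMod 6) = 0 := by decide
  have hx (x : ℕ) : ((x % 6 : ℕ) : ZMod 6) = x := ZMod.natCast_mod x 6
  rw [Nat.cast_sub (by omega)]
  simp [point, h6, hx]

theorem point_diffCode {a : ℕ} (ha : a < 36) (b : ℕ) :
    point (diffCode a b) = point b - point a := by
  rw [diffCode, point_mod, cast_sub_div ha, cast_sub_mod]

theorem five_eq_neg_one : (5 : ZMod 6) = -1 := by decide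

theorem unimodularCode_iff (m n : ℕ) :
    unimodularCode m n = true ↔ Unimodular ((m : ZMod 6), (n : ZMod 6)) := by
  rw [unimodularCode, Nat.beq_eq, Unimodular]
  have := ZMod.natCast_eq_natCast_iff' (m * m + n * n + 5 * (m * m * (n * n))) 1 6
  rw [show 1 % 6 = 1 from rfl] at this
  rw [← this]
  push_cast
  rw [five_eq_neg_one]
  ring_nf

theorem point_normalizeCode (m n k : ℕ) {a : ℕ} (ha : a < 36) (c : ℕ) :
    point (normalizeCode m n ((m + k * n) % 6) ((n * (1 + 5 * (m * m)) + 5 * (k * m)) % 6) a c) =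
      normalize ((m : ZMod 6), (n : ZMod 6)) (point a) k (point c) := by
  rw [normalizeCode, point_mod, normalize, affineMap]
  have hx (x : ℕ) : ((x % 6 : ℕ) : ZMod 6) = x := ZMod.natCast_mod x 6
  simp only [Nat.cast_add, Nat.cast_mul, hx, cast_sub_div ha, cast_sub_mod]
  push_cast
  rw [five_eq_neg_one, add_zero]
  congr 1
  · ring
  · ring

theorem points_map {L : List ℕ} {f : ℕ → ℕ} {g : ZMod 6 × ZMod 6 → ZMod 6 × ZMod 6}
    (h : ∀ c, point (f c) = g (point c)) : points (L.map f) = g '' points L := by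
  ext x
  simp [points, h]

theorem luEquiv_of_isRep {L : List ℕ} (h : isRep L = true) :
    ∃ i, LUEquiv (bell '' points L) (rep i) := by
  obtain ⟨i, hi⟩ := exists_of_isRep h
  exact ⟨i, by rw [hi]; exact LUEquiv.refl _⟩

/-- Soundness holds for any `dir`: `searchFrom` tests unimodularity itself, so `dir` only proposes
candidates. -/
theorem luEquiv_of_search {dir : ℕ → ℕ → ℕ} {L : List ℕ} (hL : ∀ c ∈ L, c < 36)
    (h : search dir L = true) : ∃ i, LUEquiv (bell '' points L) (rep i) := by
  rw [search, Bool.or_eq_true] at h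
  obtain h | h := h
  · exact luEquiv_of_isRep h
  · simp only [List.any_eq_true, force_eq] at h
    obtain ⟨a, ha, b, -, h⟩ := h
    rw [searchFrom, Bool.and_eq_true, List.any_eq_true] at h
    obtain ⟨hu, k, -, h⟩ := h
    rw [force_eq, force_eq] at h
    obtain ⟨i, hi⟩ := luEquiv_of_isRep h
    refine ⟨i, LUEquiv.trans ?_ hi⟩
    rw [points_map (point_normalizeCode _ _ k (hL a ha))]
    exact (implementable_normalize ((unimodularCode_iff _ _).1 hu) _ _).luEquiv _

/-- With 0 and (0, 1) fixed, only the unordered pairs of remaining points need checking, hence q <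
p. -/
theorem search_of_unimodular :
    ((List.range 36).all fun p => Nat.ble p 1 || (List.range p).all fun q =>
      Nat.ble q 1 || search diffCode [0, 1, p, q]) = true := by
  decide +kernel

/-- A lift of half the difference of two points that differ by a multiple of `2`. -/
def halfDiffCode (a b : ℕ) : ℕ :=
  -- Modulo 3, doubling is the same as halving; the 3 makes the second entry odd, so the vector is
  -- unimodular modulo 2. If b - a is even, then twice this vector v is b - a, and normalizing along
  -- v sends b to (0, 2).
  2 * (diffCode a b / 6) * 6 + (2 * (diffCode a b % 6) + 3) % 6

def unimodularDiff (a b : ℕ) : Bool :=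
  force (diffCode a b) fun e => unimodularCode (e / 6) (e % 6)

/-- A difference is not unimodular when it vanishes modulo 2 or modulo 3. If this holds for all
pairs, the four points all agree modulo 2 or all agree modulo 3. In the second case, as 0 is among
them, they form the last representative; in the first they lie in 2(ℤ/6)², a plane over 𝔽₃, where
halved differences supply the directions. -/
theorem search_of_not_unimodular :
    ((List.range 36).all fun p => Nat.beq p 0 || unimodularDiff 0 p ||
      (List.range 36).all fun q => Nat.beq q 0 || Nat.beq q p || unimodularDiff 0 q ||
        unimodularDiff p q ||
      (List.range 36).all fun r => Nat.beq r 0 || Nat.beq r p || Nat.beq r q ||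
        unimodularDiff 0 r || unimodularDiff p r || unimodularDiff q r ||
        search halfDiffCode [0, p, q, r]) = true := by
  decide +kernel

/-! ### Every four-point set reaches a representative -/

theorem unimodularDiff_iff {a : ℕ} (ha : a < 36) (b : ℕ) :
    unimodularDiff a b = true ↔ Unimodular (point b - point a) := by
  have hx (x : ℕ) : ((x % 6 : ℕ) : ZMod 6) = x := ZMod.natCast_mod x 6
  rw [unimodularDiff, force_eq, unimodularCode_iff, hx, ← point_diffCode ha]
  rfl

theorem unimodularDiff_eq_false {x y : ZMod 6 × ZMod 6} (h : ¬ Unimodular (y - x)) :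
    unimodularDiff (code x) (code y) = false := by
  rw [← Bool.not_eq_true, unimodularDiff_iff (code_lt x), point_code, point_code]
  exact h

theorem points_codes (x y z w : ZMod 6 × ZMod 6) :
    points [code x, code y, code z, code w] = {x, y, z, w} := by
  simp only [points_four, point_code]

theorem exists_eq_insert_of_card_eq_four {S : Finset (ZMod 6 × ZMod 6)} (hS : S.card = 4)
    {x : ZMod 6 × ZMod 6} (hx : x ∈ S) :
    ∃ y z w, y ≠ x ∧ z ≠ x ∧ w ≠ x ∧ y ≠ z ∧ y ≠ w ∧ z ≠ w ∧ S = {x, y, z, w} := by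
  have h3 : (S.erase x).card = 3 := by rw [Finset.card_erase_of_mem hx, hS]
  obtain ⟨y, z, w, hyz, hyw, hzw, e⟩ := Finset.card_eq_three.1 h3
  have hne (v) (hv : v ∈ ({y, z, w} : Finset _)) : v ≠ x := Finset.ne_of_mem_erase (e ▸ hv)
  exact ⟨y, z, w, hne _ (by simp), hne _ (by simp), hne _ (by simp), hyz, hyw, hzw,
    by rw [← e, Finset.insert_erase hx]⟩

theorem code_zero : code (0 : ZMod 6 × ZMod 6) = 0 := rfl

theorem code_zero_one : code ((0, 1) : ZMod 6 × ZMod 6) = 1 := rfl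

theorem luEquiv_of_lt {x y : ZMod 6 × ZMod 6} (hx : 1 < code x) (hy : 1 < code y)
    (hxy : code y < code x) :
    ∃ i, LUEquiv (bell '' ({0, (0, 1), x, y} : Set (ZMod 6 × ZMod 6))) (rep i) := by
  have h := search_of_unimodular
  simp only [List.all_eq_true, List.mem_range, Bool.or_eq_true, Nat.ble_eq] at h
  have h := ((h _ (code_lt x)).resolve_left (by omega) _ hxy).resolve_left (by omega)
  have hlt : ∀ c ∈ [code 0, code (0, 1), code x, code y], c < 36 := by
    simp [code_lt]
  rw [← points_codes]
  exact luEquiv_of_search hlt h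

/-- Four points with a unimodular difference. -/
theorem luEquiv_of_unimodular {S : Finset (ZMod 6 × ZMod 6)} (hS : S.card = 4)
    {a b : ZMod 6 × ZMod 6} (ha : a ∈ S) (hb : b ∈ S) (hab : Unimodular (b - a)) :
    ∃ i, LUEquiv (bell '' (S : Set (ZMod 6 × ZMod 6))) (rep i) := by
  have hf := implementable_normalize hab a 0
  set f := normalize (b - a) a 0 with hfdef
  have hfa : f a = 0 := by simp [hfdef, normalize, affineMap]
  have hfb : f b = (0, 1) := by
    unfold Unimodular at hab
    simp only [hfdef, normalize, affineMap, add_zero]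
    refine Prod.ext ?_ ?_
    · ring
    · linear_combination hab
  suffices h : ∃ i, LUEquiv (bell '' (f '' (S : Set (ZMod 6 × ZMod 6)))) (rep i) by
    obtain ⟨i, hi⟩ := h
    exact ⟨i, (hf.luEquiv _).trans hi⟩
  have hcard : (S.image f).card = 4 := by rw [Finset.card_image_of_injective _ hf.injective, hS]
  obtain ⟨y, z, w, hy, hz, hw, hyz, hyw, hzw, e⟩ :=
    exists_eq_insert_of_card_eq_four hcard (hfa ▸ Finset.mem_image_of_mem f ha)
  have h01 : ((0, 1) : ZMod 6 × ZMod 6) ∈ S.image f := hfb ▸ Finset.mem_image_of_mem f hb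
  obtain ⟨p, q, hp0, hq0, hp1, hq1, hpq, e'⟩ : ∃ p q : ZMod 6 × ZMod 6, p ≠ 0 ∧ q ≠ 0 ∧
      p ≠ (0, 1) ∧ q ≠ (0, 1) ∧ p ≠ q ∧ S.image f = {0, (0, 1), p, q} := by
    rw [e] at h01
    simp only [Finset.mem_insert, Finset.mem_singleton] at h01
    obtain h | rfl | rfl | rfl := h01
    · exact absurd h (by decide)
    · exact ⟨z, w, hz, hw, hyz.symm, hyw.symm, hzw, e⟩
    · exact ⟨y, w, hy, hw, hyz, hzw.symm, hyw, by rw [e, Finset.insert_comm y]⟩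
    · exact ⟨y, z, hy, hz, hyw, hzw, hyz,
        by rw [e, Finset.pair_comm z, Finset.insert_comm y]⟩
  rw [← Finset.coe_image, e']
  have hlt {x : ZMod 6 × ZMod 6} (h0 : x ≠ 0) (h1 : x ≠ (0, 1)) : 1 < code x := by
    have h0' := code_injective.ne h0
    have h1' := code_injective.ne h1
    rw [code_zero] at h0'
    rw [code_zero_one] at h1'
    omega
  push_cast
  -- The search covers only one order of the last two points.
  obtain h | h := lt_or_gt_of_ne (code_injective.ne hpq)
  · rw [Set.pair_comm p q]
    exact luEquiv_of_lt (hlt hq0 hq1) (hlt hp0 hp1) h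
  · exact luEquiv_of_lt (hlt hp0 hp1) (hlt hq0 hq1) h

/-- Four points without a unimodular difference. -/
theorem luEquiv_of_not_unimodular {S : Finset (ZMod 6 × ZMod 6)} (hS : S.card = 4)
    (h : ∀ a ∈ S, ∀ b ∈ S, ¬ Unimodular (b - a)) (h0 : 0 ∈ S) :
    ∃ i, LUEquiv (bell '' (S : Set (ZMod 6 × ZMod 6))) (rep i) := by
  obtain ⟨y, z, w, hy, hz, hw, hyz, hyw, hzw, rfl⟩ := exists_eq_insert_of_card_eq_four hS h0
  have hs := search_of_not_unimodular
  simp only [List.all_eq_true, List.mem_range, Bool.or_eq_true, Nat.beq_eq, or_assoc] at hs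
  have hne {u v : ZMod 6 × ZMod 6} (huv : u ≠ v) : code u ≠ code v := code_injective.ne huv
  have hu {u v : ZMod 6 × ZMod 6} (hu : u ∈ ({0, y, z, w} : Finset (ZMod 6 × ZMod 6)))
      (hv : v ∈ ({0, y, z, w} : Finset (ZMod 6 × ZMod 6))) :
      ¬ unimodularDiff (code u) (code v) = true := by
    rw [unimodularDiff_eq_false (h u hu v hv)]
    exact Bool.false_ne_true
  have hs := ((hs _ (code_lt y)).resolve_left (hne hy)).resolve_left
    (hu (u := 0) (by simp) (by simp))
  have hs := ((((hs _ (code_lt z)).resolve_left (hne hz)).resolve_left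
    (hne hyz.symm)).resolve_left (hu (u := 0) (by simp) (by simp))).resolve_left
    (hu (by simp) (by simp))
  have hs := ((((((hs _ (code_lt w)).resolve_left (hne hw)).resolve_left
    (hne hyw.symm)).resolve_left (hne hzw.symm)).resolve_left
    (hu (u := 0) (by simp) (by simp))).resolve_left (hu (by simp) (by simp))).resolve_left
    (hu (by simp) (by simp))
  have hlt : ∀ c ∈ [code 0, code y, code z, code w], c < 36 := by simp [code_lt]
  push_cast
  rw [← points_codes]
  exact luEquiv_of_search hlt hs

/-- Every set of four generalized Bell states is equivalent to a representative. -/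
theorem exists_luEquiv_rep {S : Finset (ZMod 6 × ZMod 6)} (hS : S.card = 4) :
    ∃ i, LUEquiv (bell '' (S : Set (ZMod 6 × ZMod 6))) (rep i) := by
  by_cases h : ∃ a ∈ S, ∃ b ∈ S, Unimodular (b - a)
  · obtain ⟨a, ha, b, hb, hab⟩ := h
    exact luEquiv_of_unimodular hS ha hb hab
  · push Not at h
    obtain ⟨a, ha⟩ : S.Nonempty := Finset.card_pos.1 (by omega)
    have hf := Implementable.translation (-a)
    obtain ⟨i, hi⟩ := luEquiv_of_not_unimodular (S := S.image fun p => p + -a)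
      (by rw [Finset.card_image_of_injective _ hf.injective, hS])
      (by
        intro x hx y hy
        obtain ⟨x, hxS, rfl⟩ := Finset.mem_image.1 hx
        obtain ⟨y, hyS, rfl⟩ := Finset.mem_image.1 hy
        rw [add_sub_add_right_eq_sub]
        exact h x hxS y hyS)
      (Finset.mem_image.2 ⟨a, ha, add_neg_cancel a⟩)
    rw [Finset.coe_image] at hi
    exact ⟨i, (hf.luEquiv _).trans hi⟩

/-! ### Inequivalence of the representatives and the count -/

/-- The representatives as finite sets of exponents. -/
def repFinset (i : Fin 31) : Finset (ZMod 6 × ZMod 6) := ((repCodes.get i).map point).toFinset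

theorem coe_repFinset (i : Fin 31) : (repFinset i : Set (ZMod 6 × ZMod 6)) = repExponents i := by
  rw [← points_repCodes]
  ext x
  simp [repFinset, points]

theorem card_repFinset : ∀ i, (repFinset i).card = 4 := by
  decide +kernel

/-- The profiles of the representatives. -/
def repProfiles : List ℕ :=
  [704, 736, 2585454, 460068, 387676, 47458, 61832, 768, 948322, 144614, 192706, 84268, 58676,
   791560, 15001920, 5210808, 3342076, 1965390, 4214142, 2632488, 1502416, 1563108, 1164016,
   837884, 363660, 409352, 490944, 327760, 580836, 2083584, 735720]

/-- Recovering the index from the profile gives injectivity with one lookup per representative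
instead of pairwise comparisons. -/
theorem idxOf_profile_repFinset :
    ∀ i : Fin 31, repProfiles.idxOf (profile (repFinset i)) = i := by
  decide +kernel

theorem profile_repFinset_injective : Function.Injective fun i => profile (repFinset i) := by
  intro i j h
  apply Fin.ext
  rw [← idxOf_profile_repFinset i, ← idxOf_profile_repFinset j]
  exact congrArg (fun n => repProfiles.idxOf n) h

theorem rep_eq (i : Fin 31) : rep i = bell '' (repFinset i : Set (ZMod 6 × ZMod 6)) := by
  rw [coe_repFinset]
  rfl

theorem rep_luEquiv_injective {i j : Fin 31} (h : LUEquiv (rep i) (rep j)) : i = j := by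
  rw [rep_eq, rep_eq] at h
  exact profile_repFinset_injective (profile_eq_of_luEquiv h)

theorem bellSets_eq_image (n : ℕ) :
    bellSets d n = (fun S : Finset (ZMod d × ZMod d) => bell '' (S : Set (ZMod d × ZMod d))) ''
      (Finset.powersetCard n Finset.univ : Finset (Finset (ZMod d × ZMod d))) := by
  ext S
  constructor
  · rintro ⟨hS, hn⟩
    obtain ⟨T, rfl⟩ := Set.subset_range_iff_exists_image_eq.1 hS
    rw [Set.ncard_image_of_injective _ bell_injective] at hn
    classical
    refine ⟨T.toFinset, ?_, by simp⟩
    simpa [Set.ncard_eq_toFinset_card'] using hn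
  · rintro ⟨T, hT, rfl⟩
    refine ⟨Set.image_subset_range _ _, ?_⟩
    rw [Set.ncard_image_of_injective _ bell_injective, Set.ncard_coe_finset]
    exact (Finset.mem_powersetCard.1 hT).2

theorem ncard_bellSets (n : ℕ) : (bellSets d n).ncard = (d * d).choose n := by
  rw [bellSets_eq_image, Set.ncard_image_of_injective, Set.ncard_coe_finset,
    Finset.card_powersetCard, Finset.card_univ, Fintype.card_prod, ZMod.card]
  exact bell_injective.image_injective.comp Finset.coe_injective

theorem rep_mem_bellSets (i : Fin 31) : rep i ∈ bellSets 6 4 := by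
  rw [rep_eq, bellSets_eq_image]
  exact ⟨_, by simp [card_repFinset], rfl⟩

theorem existsUnique_luEquiv_rep {S : Set (Bipartite 6)} (hS : S ∈ bellSets 6 4) :
    ∃! i : Fin 31, LUEquiv S (rep i) := by
  rw [bellSets_eq_image] at hS
  obtain ⟨T, hT, rfl⟩ := hS
  obtain ⟨i, hi⟩ := exists_luEquiv_rep (Finset.mem_powersetCard.1 hT).2
  exact ⟨i, hi, fun j hj => rep_luEquiv_injective (hj.symm.trans hi)⟩

theorem card_quotient_luSetoid : Nat.card (Quotient (luSetoid 6 4)) = 31 := by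
  let f : Fin 31 → Quotient (luSetoid 6 4) := fun i => Quotient.mk _ ⟨rep i, rep_mem_bellSets i⟩
  have hf : Function.Bijective f := by
    refine ⟨fun i j h => rep_luEquiv_injective (Quotient.exact h), fun x => ?_⟩
    induction x using Quotient.inductionOn with
    | h S =>
      obtain ⟨i, hi, -⟩ := existsUnique_luEquiv_rep S.2
      exact ⟨i, Quotient.sound hi.symm⟩
  rw [← Nat.card_eq_of_bijective f hf, Nat.card_fin]

end GBS

end

theorem mainTheorem2 :
    (GBS.bellSets 6 4).ncard = 58905 ∧
    Nat.card (Quotient (GBS.luSetoid 6 4)) = 31 ∧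
    (∀ i : Fin 31, GBS.rep i ∈ GBS.bellSets 6 4) ∧
    (∀ S ∈ GBS.bellSets 6 4, ∃! i : Fin 31, GBS.LUEquiv S (GBS.rep i)) :=
  ⟨(GBS.ncard_bellSets 4).trans (by decide), GBS.card_quotient_luSetoid, GBS.rep_mem_bellSets,
    fun _ hS => GBS.existsUnique_luEquiv_rep hS⟩
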